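/- Let $\mathcal H,\mathcal K$ be complex Hilbert spaces, and write $\mathcal B(\mathcal H)$, $\mathcal B(\mathcal K)$ for the $C^*$-algebras of bounded linear operators on them, ordered by $X\le Y$ iff $Y-X$ is positive. Let $\Phi:\mathcal B(\mathcal H)\to\mathcal B(\mathcal K)$ be a unital ($\Phi(I)=I$) $2$-positive linear map, i.e. applying $\Phi$ entrywise to any positive $2\times2$ operator matrix gives a positive $2\times 2$ operator matrix. Let $m,M$ be real numbers and let $A\in\mathcal B(\mathcal H)$ satisfy $0<m$ and $mI\le A\le MI$. Write $\Phi^p(X)=(\Phi(X))^p$ for positive $X$ and $|X|=(X^*X)^{1/2}$. Then for all real $\alpha$ and $p$ with $1\le\alpha\le 2$ and $p\ge\alpha$, $$\left|\Phi^p(A^{-1})\Phi^p(A)+\Phi^p(A)\Phi^p(A^{-1})\right|\le \frac{(M^\alpha+m^\alpha)^{\frac{2p}{\alpha}}}{2M^pm^p}\,I$$ and $$\Phi^p(A^{-1})\Phi^p(A)+\Phi^p(A)\Phi^p(A^{-1})\le \frac{(M^\alpha+m^\alpha)^{\frac{2p}{\alpha}}}{2M^pm^p}\,I .$$ -/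

import Mathlib

/-- A linear map `Φ` between C⋆-algebras is 2-positive if applying `Φ` entrywise sends every
positive `2 × 2` matrix to a positive `2 × 2` matrix. A matrix `M ≥ 0` is self-adjoint, so it is
automatically of the form `[A, B; B⋆, C]`. -/
def IsTwoPositive {A₁ A₂ : Type*} [CStarAlgebra A₁] [PartialOrder A₁] [StarOrderedRing A₁]
    [CStarAlgebra A₂] [PartialOrder A₂] [StarOrderedRing A₂] (Φ : A₁ →ₗ[ℂ] A₂) : Prop :=
  ∀ M : CStarMatrix (Fin 2) (Fin 2) A₁, 0 ≤ M → 0 ≤ M.map Φ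

section CStarAlgebra
variable {A : Type*} [CStarAlgebra A] [PartialOrder A] [StarOrderedRing A]

theorem CStarMatrix.quadratic_form_nonneg {M : CStarMatrix (Fin 2) (Fin 2) A} (hM : 0 ≤ M)
    (v w : A) :
    0 ≤ star v * M 0 0 * v + star v * M 0 1 * w + star w * M 1 0 * v + star w * M 1 1 * w := by
  rw [StarOrderedRing.nonneg_iff] at hM
  induction hM using AddSubmonoid.closure_induction with
  | mem M hM =>
    obtain ⟨N, rfl⟩ := hM
    have key : ∀ i j, (star N * N) i j = star (N 0 i) * N 0 j + star (N 1 i) * N 1 j := by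
      intro i j
      simp [CStarMatrix.mul_apply, CStarMatrix.star_apply, Fin.sum_univ_two]
    have h := add_nonneg (star_mul_self_nonneg (N 0 0 * v + N 0 1 * w))
      (star_mul_self_nonneg (N 1 0 * v + N 1 1 * w))
    simp only [key]
    refine h.trans_eq ?_
    simp only [star_add, star_mul]
    noncomm_ring
  | zero => simp
  | add M N _ _ hM hN =>
    refine (add_nonneg hM hN).trans_eq ?_
    simp only [CStarMatrix.add_apply]
    noncomm_ring

theorem CStarMatrix.gram_nonneg (s t : A) :
    0 ≤ CStarMatrix.ofMatrix !![star s * s, star s * t; star t * s, star t * t] := by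
  refine (star_mul_self_nonneg (CStarMatrix.ofMatrix !![s, t; 0, 0])).trans_eq ?_
  ext i j
  fin_cases i <;> fin_cases j <;>
    simp [CStarMatrix.mul_apply, CStarMatrix.star_apply, Fin.sum_univ_two]

theorem mul_add_mul_le_half_of_add_le_one {P Q : A} (hP : 0 ≤ P) (hQ : 0 ≤ Q) (h : P + Q ≤ 1) :
    2 • (P * Q + Q * P) ≤ 1 ∧ -1 ≤ 2 • (P * Q + Q * P) := by
  have hR : 0 ≤ 1 - P - Q := by rw [sub_sub]; exact sub_nonneg.mpr h
  have hPs : IsSelfAdjoint P := .of_nonneg hP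
  have h2P : IsSelfAdjoint (2 • P) := by rw [two_nsmul]; exact hPs.add hPs
  have h1 : 0 ≤ (1 - 2 • P) * Q * (1 - 2 • P) :=
    IsSelfAdjoint.conjugate_nonneg hQ (.sub (.one _) h2P)
  have h2 : 0 ≤ (1 + 2 • P) * Q * (1 + 2 • P) :=
    IsSelfAdjoint.conjugate_nonneg hQ (.add (.one _) h2P)
  have h3 : 0 ≤ (1 - 2 • P) * P * (1 - 2 • P) :=
    IsSelfAdjoint.conjugate_nonneg hP (.sub (.one _) h2P)
  have h4 : 0 ≤ 4 • (P * (1 - P - Q) * P) := nsmul_nonneg (hPs.conjugate_nonneg hR) 4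
  constructor
  · rw [← sub_nonneg]
    refine (add_nonneg (add_nonneg h1 hR) (add_nonneg h4 h3)).trans_eq ?_
    noncomm_ring
  · rw [← sub_nonneg]
    refine (add_nonneg (add_nonneg h2 hR) (add_nonneg h4 h3)).trans_eq ?_
    noncomm_ring

theorem mul_add_mul_le_of_add_le_smul_one {P Q : A} (hP : 0 ≤ P) (hQ : 0 ≤ Q) {c : ℝ} (hc : 0 < c)
    (h : P + Q ≤ c • (1 : A)) :
    P * Q + Q * P ≤ (c ^ 2 / 2) • (1 : A) ∧ -((c ^ 2 / 2) • (1 : A)) ≤ P * Q + Q * P := by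
  have hc' : (0 : ℝ) ≤ c⁻¹ := by positivity
  have h' : c⁻¹ • P + c⁻¹ • Q ≤ 1 := by
    rw [← smul_add]
    refine (smul_le_smul_of_nonneg_left h hc').trans_eq ?_
    rw [smul_smul, inv_mul_cancel₀ hc.ne', one_smul]
  obtain ⟨h1, h2⟩ := mul_add_mul_le_half_of_add_le_one (smul_nonneg hc' hP) (smul_nonneg hc' hQ) h'
  have h0 : (0 : ℝ) ≤ c ^ 2 / 2 := by positivity
  have e : (c ^ 2 / 2) • (2 • ((c⁻¹ • P) * (c⁻¹ • Q) + (c⁻¹ • Q) * (c⁻¹ • P))) =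
      P * Q + Q * P := by
    simp only [smul_mul_smul_comm, ← smul_add, ← Nat.cast_smul_eq_nsmul ℝ, smul_smul]
    rw [show c ^ 2 / 2 * (((2 : ℕ) : ℝ) * (c⁻¹ * c⁻¹)) = 1 by push_cast; field_simp, one_smul]
  rw [← e, ← smul_neg]
  exact ⟨smul_le_smul_of_nonneg_left h1 h0, smul_le_smul_of_nonneg_left h2 h0⟩

theorem CFC.abs_le_smul_one {X : A} (hX : IsSelfAdjoint X) {k : ℝ}
    (h1 : X ≤ k • (1 : A)) (h2 : -(k • (1 : A)) ≤ X) : CFC.abs X ≤ k • (1 : A) := by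
  rw [← Algebra.algebraMap_eq_smul_one] at *
  rw [CFC.abs_eq_cfc_norm X]
  refine cfc_le_algebraMap _ _ _ fun x hx ↦ ?_
  rw [← map_neg] at h2
  rw [Real.norm_eq_abs, abs_le]
  exact ⟨(algebraMap_le_iff_le_spectrum (a := X)).mp h2 x hx,
    (le_algebraMap_iff_spectrum_le (a := X)).mp h1 x hx⟩

theorem CFC.real_smul_rpow {k : ℝ} (hk : 0 ≤ k) {X : A} (hX : 0 ≤ X) {p : ℝ} (hp : 0 ≤ p) :
    (k • X) ^ p = k ^ p • X ^ p := by
  rw [CFC.rpow_eq_cfc_real (smul_nonneg hk hX), CFC.rpow_eq_cfc_real hX,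
    ← cfc_comp_smul k (fun x : ℝ ↦ x ^ p) X (by fun_prop (disch := grind)),
    ← cfc_smul (k ^ p) (fun x : ℝ ↦ x ^ p) X (by fun_prop (disch := grind))]
  refine cfc_congr fun x hx ↦ ?_
  simp only [smul_eq_mul]
  exact Real.mul_rpow hk (spectrum_nonneg_of_nonneg hX hx)

theorem CFC.rpow_le_smul_of_le_smul_one {X : A} (hX : 0 ≤ X) {c r : ℝ} (hr : 1 ≤ r)
    (h : X ≤ c • (1 : A)) : X ^ r ≤ c ^ (r - 1) • X := by
  rw [← Algebra.algebraMap_eq_smul_one] at h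
  rw [CFC.rpow_eq_cfc_real hX, ← cfc_const_mul_id (c ^ (r - 1)) X]
  refine cfc_mono (fun x hx ↦ ?_) (by fun_prop (disch := grind))
  have hx0 : 0 ≤ x := spectrum_nonneg_of_nonneg hX hx
  have hxc : x ≤ c := (le_algebraMap_iff_spectrum_le (a := X)).mp h x hx
  calc x ^ r = x ^ (r - 1) * x := by
        rw [← Real.rpow_add_one' hx0 (by linarith)]; congr 1; ring
    _ ≤ c ^ (r - 1) * x := by gcongr

theorem CFC.rpow_add_rpow_le_of_add_le {X Y : A} (hX : 0 ≤ X) (hY : 0 ≤ Y) {c r : ℝ} (hc : 0 ≤ c)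
    (hr : 1 ≤ r) (h : X + Y ≤ c • (1 : A)) : X ^ r + Y ^ r ≤ c ^ r • (1 : A) := by
  have h1 := CFC.rpow_le_smul_of_le_smul_one hX hr ((le_add_of_nonneg_right hY).trans h)
  have h2 := CFC.rpow_le_smul_of_le_smul_one hY hr ((le_add_of_nonneg_left hX).trans h)
  have hc' : 0 ≤ c ^ (r - 1) := Real.rpow_nonneg hc _
  calc X ^ r + Y ^ r ≤ c ^ (r - 1) • X + c ^ (r - 1) • Y := add_le_add h1 h2
    _ = c ^ (r - 1) • (X + Y) := (smul_add _ _ _).symm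
    _ ≤ c ^ (r - 1) • (c • (1 : A)) := smul_le_smul_of_nonneg_left h hc'
    _ = c ^ r • (1 : A) := by
      rw [smul_smul, ← Real.rpow_add_one' hc (by linarith)]; congr 2; ring

theorem rpow_add_div_rpow_le {m M x α : ℝ} (hm : 0 < m) (hmx : m ≤ x) (hxM : x ≤ M)
    (hα : 0 ≤ α) : x ^ α + (M * m * x⁻¹) ^ α ≤ M ^ α + m ^ α := by
  have hx : 0 < x := hm.trans_le hmx
  have hM : 0 < M := hx.trans_le hxM
  rw [Real.mul_rpow (by positivity) (by positivity), Real.mul_rpow hM.le hm.le,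
    Real.inv_rpow hx.le]
  have h1 : m ^ α ≤ x ^ α := by gcongr
  have h2 : x ^ α ≤ M ^ α := by gcongr
  have h3 : 0 < x ^ α := by positivity
  have h4 : 0 ≤ ((M ^ α - x ^ α) * (x ^ α - m ^ α)) * (x ^ α)⁻¹ :=
    mul_nonneg (mul_nonneg (by linarith) (by linarith)) (by positivity)
  rw [← sub_nonneg]
  refine h4.trans_eq ?_
  field_simp
  ring

theorem CFC.rpow_add_smul_inverse_rpow_le {a : A} {m M α : ℝ} (hm : 0 < m)
    (hma : m • (1 : A) ≤ a) (haM : a ≤ M • (1 : A)) (hα : 0 ≤ α) :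
    0 ≤ a ∧ 0 ≤ Ring.inverse a ∧
    a ^ α + ((M * m) • Ring.inverse a) ^ α ≤ (M ^ α + m ^ α) • (1 : A) := by
  have ha : 0 ≤ a := (smul_nonneg hm.le zero_le_one).trans hma
  rw [← Algebra.algebraMap_eq_smul_one] at *
  have hsa : IsSelfAdjoint a := .of_nonneg ha
  have hlo : ∀ x ∈ spectrum ℝ a, m ≤ x := (algebraMap_le_iff_le_spectrum (a := a)).mp hma
  have hhi : ∀ x ∈ spectrum ℝ a, x ≤ M := (le_algebraMap_iff_spectrum_le (a := a)).mp haM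
  have hne : ∀ x ∈ spectrum ℝ a, x ≠ 0 := fun x hx ↦ (hm.trans_le (hlo x hx)).ne'
  have hinv : Ring.inverse a = cfc (fun x : ℝ ↦ x⁻¹) a := by
    rw [cfc_inv (fun x : ℝ ↦ x) a hne, cfc_id' ℝ a]
  have hcont : ContinuousOn (fun x : ℝ ↦ x⁻¹) (spectrum ℝ a) := by fun_prop (disch := assumption)
  refine ⟨ha, ?_, ?_⟩
  · rw [hinv]
    exact cfc_nonneg fun x hx ↦ _root_.inv_nonneg.mpr (hm.le.trans (hlo x hx))
  nontriviality A
  have hM : 0 < M := by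
    obtain ⟨x, hx⟩ := ContinuousFunctionalCalculus.spectrum_nonempty (R := ℝ) a hsa
    exact hm.trans_le ((hlo x hx).trans (hhi x hx))
  rw [hinv, ← cfc_const_mul (M * m) (fun x : ℝ ↦ x⁻¹) a hcont,
    CFC.cfc_rpow (f := fun x ↦ M * m * x⁻¹)
      (fun x hx ↦ by have := hm.trans_le (hlo x hx); positivity) (by fun_prop),
    CFC.rpow_eq_cfc_real ha,
    ← cfc_add (a := a) (fun x : ℝ ↦ x ^ α) (fun x ↦ (M * m * x⁻¹) ^ α)
      (by fun_prop (disch := grind))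
      (by fun_prop (disch := grind))]
  exact cfc_le_algebraMap _ _ _ fun x hx ↦ rpow_add_div_rpow_le hm (hlo x hx) (hhi x hx) hα

end CStarAlgebra

open MeasureTheory Set Real in
theorem CFC.integrableOn_and_rpow_eq_setIntegral_cfcₙ_rpowIntegrand₁₂ {A : Type*} [CStarAlgebra A]
    [PartialOrder A] [StarOrderedRing A] {p : ℝ} (hp : p ∈ Ioo 1 2) {μ : Measure ℝ}
    (hμ : ∀ x ∈ Ici (0 : ℝ), IntegrableOn (fun t ↦ rpowIntegrand₁₂ p t x) (Ioi 0) μ ∧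
      x ^ p = ∫ t in Ioi 0, rpowIntegrand₁₂ p t x ∂μ) {a : A} (ha : 0 ≤ a) :
    IntegrableOn (fun t ↦ cfcₙ (rpowIntegrand₁₂ p t) a) (Ioi 0) μ ∧
      a ^ p = ∫ t in Ioi 0, cfcₙ (rpowIntegrand₁₂ p t) a ∂μ := by
  have hspec : ∀ x ∈ quasispectrum ℝ a, 0 ≤ x := fun x hx ↦
    quasispectrum_nonneg_of_nonneg a ha x hx
  let maxr := sSup (quasispectrum ℝ a)
  have hbdd : BddAbove (quasispectrum ℝ a) := (quasispectrum.isCompact a).bddAbove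
  have maxr_nonneg : 0 ≤ maxr := le_csSup_of_le (b := 0) hbdd (by simp) le_rfl
  have hf : ContinuousOn (Function.uncurry (rpowIntegrand₁₂ p))
      (Ioi (0 : ℝ) ×ˢ quasispectrum ℝ a) :=
    continuousOn_rpowIntegrand₁₂_uncurry hp.1 (quasispectrum ℝ a) hspec
  have hbound : ∀ᵐ t ∂μ.restrict (Ioi 0), ∀ z ∈ quasispectrum ℝ a,
      ‖rpowIntegrand₁₂ p t z‖ ≤ ‖rpowIntegrand₁₂ p t maxr‖ := by
    filter_upwards [ae_restrict_mem measurableSet_Ioi] with t ht z hz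
    rw [Real.norm_of_nonneg (rpowIntegrand₁₂_nonneg hp.1 ht.le (hspec z hz)),
      Real.norm_of_nonneg (rpowIntegrand₁₂_nonneg hp.1 ht.le maxr_nonneg)]
    exact monotoneOn_rpowIntegrand₁₂ hp ht (hspec z hz) maxr_nonneg (le_csSup hbdd hz)
  have hfin : HasFiniteIntegral (fun t ↦ ‖rpowIntegrand₁₂ p t maxr‖) (μ.restrict (Ioi 0)) := by
    rw [hasFiniteIntegral_norm_iff]
    exact (hμ maxr maxr_nonneg).1.2
  have hzero : ∀ᵐ t ∂μ.restrict (Ioi 0), rpowIntegrand₁₂ p t 0 = 0 := by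
    filter_upwards [ae_restrict_mem measurableSet_Ioi] with t ht
    exact rpowIntegrand₁₂_zero ht
  refine ⟨integrableOn_cfcₙ measurableSet_Ioi _ _ a hf hzero hbound hfin, ?_⟩
  rw [← cfcₙ_setIntegral measurableSet_Ioi _ _ a hf hzero hbound hfin ha.isSelfAdjoint,
    CFC.rpow_eq_cfc_real ha, ← cfcₙ_eq_cfc (f := fun x : ℝ ↦ x ^ p)
      (Real.continuous_rpow_const (by linarith [hp.1])).continuousOn
      (Real.zero_rpow (by linarith [hp.1]))]
  exact cfcₙ_congr fun x hx ↦ (hμ x (hspec x hx)).2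

open Set Real in
theorem CFC.cfcₙ_rpowIntegrand₁₂_eq {A : Type*} [CStarAlgebra A] [PartialOrder A]
    [StarOrderedRing A] {p t : ℝ} (ht : 0 < t) {a : A} (ha : 0 ≤ a) :
    cfcₙ (rpowIntegrand₁₂ p t) a =
      t ^ (p - 1) • (t⁻¹ • a + t • Ring.inverse (t • (1 : A) + a) - 1) := by
  have hspec : ∀ x ∈ spectrum ℝ a, 0 ≤ x := fun x hx ↦ spectrum_nonneg_of_nonneg ha hx
  have hne : ∀ x ∈ spectrum ℝ a, t + x ≠ 0 := fun x hx ↦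
    (add_pos_of_pos_of_nonneg ht (hspec x hx)).ne'
  have hinv : ContinuousOn (fun x : ℝ ↦ (t + x)⁻¹) (spectrum ℝ a) := by
    fun_prop (disch := assumption)
  have hq : ContinuousOn (rpowIntegrand₁₂ p t) (quasispectrum ℝ a) := by
    unfold rpowIntegrand₁₂
    have : ∀ x ∈ quasispectrum ℝ a, t + x ≠ 0 := fun x hx ↦
      (add_pos_of_pos_of_nonneg ht (quasispectrum_nonneg_of_nonneg a ha x hx)).ne'
    fun_prop (disch := assumption)
  rw [cfcₙ_eq_cfc hq (rpowIntegrand₁₂_zero ht)]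
  have h1 : ContinuousOn (fun x : ℝ ↦ t⁻¹ * x) (spectrum ℝ a) := by fun_prop
  have h2 : ContinuousOn (fun x : ℝ ↦ t * (t + x)⁻¹) (spectrum ℝ a) := hinv.const_mul t
  have h3 : ContinuousOn (fun x : ℝ ↦ t⁻¹ * x + t * (t + x)⁻¹) (spectrum ℝ a) := h1.add h2
  have h4 : ContinuousOn (fun x : ℝ ↦ t⁻¹ * x + t * (t + x)⁻¹ - 1) (spectrum ℝ a) :=
    h3.sub continuousOn_const
  unfold rpowIntegrand₁₂
  rw [cfc_const_mul _ _ a h4, cfc_sub _ (fun _ ↦ (1 : ℝ)) a h3 continuousOn_const,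
    cfc_add a _ _ h1 h2, cfc_const_mul _ _ a hinv, cfc_const_mul_id t⁻¹ a, cfc_const_one ℝ a,
    cfc_inv (fun x : ℝ ↦ t + x) a hne (by fun_prop), cfc_const_add t (fun x ↦ x) a (by fun_prop),
    cfc_id' ℝ a, Algebra.algebraMap_eq_smul_one]

theorem IsStrictlyPositive.smul_one_add {A : Type*} [CStarAlgebra A] [PartialOrder A]
    [StarOrderedRing A] {t : ℝ} (ht : 0 < t) {a : A} (ha : 0 ≤ a) :
    IsStrictlyPositive (t • (1 : A) + a) :=
  IsStrictlyPositive.add_nonneg (isStrictlyPositive_one.smul ht) ha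

namespace IsTwoPositive

variable {A₁ A₂ : Type*} [CStarAlgebra A₁] [PartialOrder A₁] [StarOrderedRing A₁]
  [CStarAlgebra A₂] [PartialOrder A₂] [StarOrderedRing A₂] {Φ : A₁ →ₗ[ℂ] A₂}

theorem quadratic_form_nonneg (hΦ : IsTwoPositive Φ) (s t : A₁) (v w : A₂) :
    0 ≤ star v * Φ (star s * s) * v + star v * Φ (star s * t) * w +
      star w * Φ (star t * s) * v + star w * Φ (star t * t) * w :=
  CStarMatrix.quadratic_form_nonneg (hΦ _ (CStarMatrix.gram_nonneg s t)) v w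

theorem map_nonneg (hΦ : IsTwoPositive Φ) {x : A₁} (hx : 0 ≤ x) : 0 ≤ Φ x := by
  obtain ⟨s, rfl⟩ := CStarAlgebra.nonneg_iff_eq_star_mul_self.mp hx
  simpa using hΦ.quadratic_form_nonneg s 0 1 0

theorem map_mono (hΦ : IsTwoPositive Φ) {x y : A₁} (h : x ≤ y) : Φ x ≤ Φ y := by
  rw [← sub_nonneg, ← map_sub]
  exact hΦ.map_nonneg (sub_nonneg.mpr h)

theorem continuous (hΦ : IsTwoPositive Φ) : Continuous Φ :=
  ContinuousMapClass.map_continuous (PositiveLinearMap.mk₀ Φ fun _ ↦ hΦ.map_nonneg)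

theorem inverse_map_le (hΦ : IsTwoPositive Φ) {x : A₁} (hx : IsStrictlyPositive x)
    (hΦx : IsStrictlyPositive (Φ x)) (hΦ_one : Φ 1 = 1) :
    Ring.inverse (Φ x) ≤ Φ (Ring.inverse x) := by
  have hi : star (Ring.inverse (Φ x)) = Ring.inverse (Φ x) := hΦx.ringInverse.isSelfAdjoint
  have hst (y : ℝ) : star (x ^ y) = x ^ y := (IsSelfAdjoint.of_nonneg CFC.rpow_nonneg)
  have h := hΦ.quadratic_form_nonneg (x ^ (1 / 2 : ℝ)) (x ^ (-(1 / 2) : ℝ))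
    (Ring.inverse (Φ x)) (-1)
  simp only [hst, ← CFC.rpow_add hx.isUnit, hi] at h
  norm_num [CFC.rpow_zero x hx.nonneg, CFC.rpow_one x hx.nonneg, hΦ_one] at h
  rw [Ring.inverse_mul_cancel _ hΦx.isUnit, one_mul, ← CFC.inverse_eq_rpow_neg_one hx] at h
  rw [← sub_nonneg]
  refine h.trans_eq ?_
  abel

theorem map_sq_le (hΦ : IsTwoPositive Φ) (hΦ_one : Φ 1 = 1) {x : A₁} (hx : IsSelfAdjoint x)
    (hΦx : IsSelfAdjoint (Φ x)) : Φ x ^ 2 ≤ Φ (x ^ 2) := by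
  have h := hΦ.quadratic_form_nonneg x 1 1 (-Φ x)
  simp only [hx.star_eq, star_neg, hΦx.star_eq, star_one, one_mul, mul_one, hΦ_one] at h
  rw [← sub_nonneg, pow_two, pow_two]
  refine h.trans_eq ?_
  noncomm_ring

open MeasureTheory Set Real in
/-- Operator Jensen inequality for the operator convex powers. -/
theorem map_rpow_le (hΦ : IsTwoPositive Φ) (hΦ_one : Φ 1 = 1) {x : A₁} (hx : 0 ≤ x) {α : ℝ}
    (hα₁ : 1 ≤ α) (hα₂ : α ≤ 2) : Φ x ^ α ≤ Φ (x ^ α) := by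
  have hΦx := hΦ.map_nonneg hx
  rcases hα₁.eq_or_lt with rfl | hα₁
  · rw [CFC.rpow_one x, CFC.rpow_one (Φ x)]
  rcases hα₂.eq_or_lt with rfl | hα₂
  · have h := hΦ.map_sq_le hΦ_one (.of_nonneg hx) (.of_nonneg hΦx)
    rwa [← CFC.rpow_natCast x, ← CFC.rpow_natCast (Φ x)] at h
  obtain ⟨μ, hμ⟩ := exists_measure_rpow_eq_integral_rpowIntegrand₁₂ (p := α) ⟨hα₁, hα₂⟩
  obtain ⟨hi₁, he₁⟩ :=
    CFC.integrableOn_and_rpow_eq_setIntegral_cfcₙ_rpowIntegrand₁₂ ⟨hα₁, hα₂⟩ hμ hx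
  obtain ⟨hi₂, he₂⟩ :=
    CFC.integrableOn_and_rpow_eq_setIntegral_cfcₙ_rpowIntegrand₁₂ ⟨hα₁, hα₂⟩ hμ hΦx
  let Ψ : A₁ →L[ℂ] A₂ := ⟨Φ, hΦ.continuous⟩
  have hΨ (y : A₁) : Φ y = Ψ y := rfl
  rw [he₁, he₂, hΨ (∫ t in Ioi 0, _ ∂μ), ← Ψ.integral_comp_comm hi₁]
  refine integral_mono_ae hi₂ (Ψ.integrable_comp hi₁) ?_
  filter_upwards [ae_restrict_mem measurableSet_Ioi] with t (ht : 0 < t)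
  have hmap : Φ (t • (1 : A₁) + x) = t • (1 : A₂) + Φ x := by
    rw [map_add, LinearMap.map_smul_of_tower, hΦ_one]
  have hinv := hΦ.inverse_map_le (IsStrictlyPositive.smul_one_add ht hx) (hmap ▸ IsStrictlyPositive.smul_one_add ht hΦx) hΦ_one
  rw [hmap] at hinv
  rw [CFC.cfcₙ_rpowIntegrand₁₂_eq ht hx, CFC.cfcₙ_rpowIntegrand₁₂_eq ht hΦx, ← hΨ]
  simp only [LinearMap.map_smul_of_tower, map_sub, map_add, hΦ_one]
  gcongr

end IsTwoPositive

theorem theorem2p6 {H K : Type*}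
    [NormedAddCommGroup H] [InnerProductSpace ℂ H] [CompleteSpace H]
    [NormedAddCommGroup K] [InnerProductSpace ℂ K] [CompleteSpace K]
    (Φ : (H →L[ℂ] H) →ₗ[ℂ] (K →L[ℂ] K)) (hΦ : IsTwoPositive Φ) (hΦ_one : Φ 1 = 1)
    (m M : ℝ) (hm : 0 < m) (A : H →L[ℂ] H)
    (hmA : m • (1 : H →L[ℂ] H) ≤ A) (hAM : A ≤ M • (1 : H →L[ℂ] H))
    (α p : ℝ) (hα₁ : 1 ≤ α) (hα₂ : α ≤ 2) (hp : α ≤ p) :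
    CFC.abs (Φ (Ring.inverse A) ^ p * Φ A ^ p + Φ A ^ p * Φ (Ring.inverse A) ^ p) ≤
        ((M ^ α + m ^ α) ^ (2 * p / α) / (2 * M ^ p * m ^ p)) • (1 : K →L[ℂ] K) ∧
      Φ (Ring.inverse A) ^ p * Φ A ^ p + Φ A ^ p * Φ (Ring.inverse A) ^ p ≤
        ((M ^ α + m ^ α) ^ (2 * p / α) / (2 * M ^ p * m ^ p)) • (1 : K →L[ℂ] K) := by
  rcases subsingleton_or_nontrivial (K →L[ℂ] K) with _ | _
  · exact ⟨(Subsingleton.elim _ _).le, (Subsingleton.elim _ _).le⟩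
  have hα : 0 < α := by linarith
  obtain ⟨hA, hA', hsum⟩ := CFC.rpow_add_smul_inverse_rpow_le hm hmA hAM hα.le
  have hM : 0 < M := by
    have h := hΦ.map_mono (hmA.trans hAM)
    rw [LinearMap.map_smul_of_tower, LinearMap.map_smul_of_tower, hΦ_one] at h
    by_contra! hM
    have h1 : (0 : K →L[ℂ] K) ≤ (M - m) • 1 := by rwa [sub_smul, sub_nonneg]
    have h2 : (m - M) • (1 : K →L[ℂ] K) = 0 :=
      le_antisymm (by rw [← neg_sub, neg_smul]; exact neg_nonpos.mpr h1)
        (smul_nonneg (by linarith) zero_le_one)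
    rcases smul_eq_zero.mp h2 with h3 | h3
    · linarith
    · exact one_ne_zero h3
  set B : H →L[ℂ] H := Ring.inverse A
  have hMm : 0 < M * m := mul_pos hM hm
  have hΦA := hΦ.map_nonneg hA
  have hΦB := hΦ.map_nonneg hA'
  have hpow : 0 < M ^ α + m ^ α := by positivity
  have hJ : Φ A ^ α + ((M * m) • Φ B) ^ α ≤ (M ^ α + m ^ α) • (1 : K →L[ℂ] K) := by
    have h1 := hΦ.map_rpow_le hΦ_one hA hα₁ hα₂
    have h2 := hΦ.map_rpow_le hΦ_one (smul_nonneg hMm.le hA') hα₁ hα₂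
    have h3 := hΦ.map_mono hsum
    rw [map_add, LinearMap.map_smul_of_tower, hΦ_one] at h3
    rw [LinearMap.map_smul_of_tower] at h2
    exact (add_le_add h1 h2).trans h3
  have hr : 1 ≤ p / α := (one_le_div hα).mpr hp
  have hP := CFC.rpow_add_rpow_le_of_add_le CFC.rpow_nonneg CFC.rpow_nonneg hpow.le hr hJ
  rw [CFC.rpow_rpow_of_exponent_nonneg _ _ _ hα.le (by linarith) hΦA,
    CFC.rpow_rpow_of_exponent_nonneg _ _ _ hα.le (by linarith) (smul_nonneg hMm.le hΦB),
    mul_div_cancel₀ _ hα.ne', CFC.real_smul_rpow hMm.le hΦB (by linarith)] at hP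
  have hk : 0 < (M * m) ^ p := Real.rpow_pos_of_pos hMm p
  obtain ⟨hu, hl⟩ := mul_add_mul_le_of_add_le_smul_one CFC.rpow_nonneg
    (smul_nonneg hk.le CFC.rpow_nonneg) (Real.rpow_pos_of_pos hpow _) hP
  set X := Φ B ^ p * Φ A ^ p + Φ A ^ p * Φ B ^ p with hX
  have hXs : IsSelfAdjoint X := by
    rw [hX, IsSelfAdjoint, star_add, star_mul, star_mul,
      (IsSelfAdjoint.of_nonneg (CFC.rpow_nonneg (a := Φ A) (y := p))).star_eq,
      (IsSelfAdjoint.of_nonneg (CFC.rpow_nonneg (a := Φ B) (y := p))).star_eq, add_comm]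
  have hkX : Φ A ^ p * ((M * m) ^ p • Φ B ^ p) + ((M * m) ^ p • Φ B ^ p) * Φ A ^ p =
      (M * m) ^ p • X := by
    rw [mul_smul_comm, smul_mul_assoc, ← smul_add, add_comm]
  have hc : (M ^ α + m ^ α) ^ (2 * p / α) / (2 * M ^ p * m ^ p) =
      ((M * m) ^ p)⁻¹ * (((M ^ α + m ^ α) ^ (p / α)) ^ 2 / 2) := by
    rw [← Real.rpow_natCast, ← Real.rpow_mul hpow.le, Real.mul_rpow hM.le hm.le,
      show p / α * ((2 : ℕ) : ℝ) = 2 * p / α by push_cast; ring]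
    field_simp
  rw [hkX] at hu hl
  have hXk : X = ((M * m) ^ p)⁻¹ • ((M * m) ^ p • X) := by
    rw [smul_smul, inv_mul_cancel₀ hk.ne', one_smul]
  have hu' : X ≤ ((M ^ α + m ^ α) ^ (2 * p / α) / (2 * M ^ p * m ^ p)) • (1 : K →L[ℂ] K) := by
    rw [hXk, hc, mul_smul]
    exact smul_le_smul_of_nonneg_left hu (by positivity)
  have hl' : -(((M ^ α + m ^ α) ^ (2 * p / α) / (2 * M ^ p * m ^ p)) • (1 : K →L[ℂ] K)) ≤ X := by
    rw [hXk, hc, mul_smul, ← smul_neg]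
    exact smul_le_smul_of_nonneg_left hl (by positivity)
  exact ⟨CFC.abs_le_smul_one hXs hu' hl', hu'⟩
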